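/- Let $n$ be even and let $d=2^n$. A one-round brickwork circuit with periodic boundary conditions on $n$ qubits is $U=U^{(2)}U^{(1)}$, where $U^{(1)}$ is a tensor product of $n/2$ two-qubit unitaries acting on the qubit pairs $(2i-1,2i)$, and $U^{(2)}$ is a tensor product of $n/2$ two-qubit unitaries acting on the pairs $(2i,2i+1)$, $i=1,\dots,n/2$, with qubit $n+1$ identified with qubit $1$. All $n$ bricks are independent and uniformly distributed on the two-qubit Clifford group (modulo global phases). Put $E_{i,U}=U^\dagger|i\rangle\langle i|U$ for $i\in\{0,1\}^n$, write $(A|B)=\operatorname{Tr}(A^\dagger B)$, and let $$S(\rho)=\sum_i\mathbb E_U\,(E_{i,U}|\rho)\,E_{i,U}$$ be the frame operator. For $v\in\mathbb F_2^{2n}$ let $W(v)$ be the corresponding $n$-qubit Pauli operator and $\langle v|S|v\rangle=\frac1d\,(W(v)|S(W(v)))$. Then $S$ is invertible, $\langle v|S|v\rangle>0$, and the estimator $f_{W(v)}(i,U)=(W(v)|S^{-1}(E_{i,U}))$ equals $\frac{1}{\langle v|S|v\rangle}(W(v)|E_{i,U})$. For a state $\rho$ let $$M(v,\rho)=\sum_i\mathbb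 E_U\,f_{W(v)}(i,U)^2\,(E_{i,U}|\rho),\qquad \sigma^2(v,\rho)=M(v,\rho)-\operatorname{Tr}(W(v)\rho)^2$$ be the second moment and the variance of a single sample. For every $v\in\mathbb F_2^{2n}$, the variance up to its first-moment term, that is $M(v,\rho)=\sigma^2(v,\rho)+\operatorname{Tr}(W(v)\rho)^2$, does not depend on the state $\rho$, and for every state $\rho$ $$\sigma^2(v,\rho)\le\frac1{\langle v|S|v\rangle},\qquad M(v,\rho)\le\frac1{\langle v|S|v\rangle}.$$ -/

import Mathlib

open Complex Finset
open scoped Matrix BigOperators ComplexOrder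

noncomputable section

namespace BrickworkShadows

/-! ### Qubits and Pauli operators -/

/-- Labels of the computational basis of `n` qubits: bit strings of length `n`. -/
abbrev Bits (n : ℕ) : Type := Fin n → Fin 2

/-- Operators on the `2 ^ n`-dimensional Hilbert space of `n` qubits. -/
abbrev Op (n : ℕ) : Type := Matrix (Bits n) (Bits n) ℂ

/-- The unitary group `U(2 ^ n)`. -/
abbrev UGroup (n : ℕ) : Type := Matrix.unitaryGroup (Bits n) ℂ

/-- The binary vectors `v = v₁ ⊕ ⋯ ⊕ vₙ ∈ 𝔽₂²ⁿ`, with `vᵢ = (zᵢ, xᵢ)`. -/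
abbrev PauliLabel (n : ℕ) : Type := Fin n → ZMod 2 × ZMod 2

/-- Single-qubit Pauli operators:
`W(0,0) = 1`, `W(0,1) = X`, `W(1,0) = Z`, `W(1,1) = Y`. -/
def pauli1 (a : ZMod 2 × ZMod 2) : Matrix (Fin 2) (Fin 2) ℂ :=
  if a = (0, 0) then !![1, 0; 0, 1]
  else if a = (0, 1) then !![0, 1; 1, 0]
  else if a = (1, 0) then !![1, 0; 0, -1]
  else !![0, -I; I, 0]

/-- The `n`-qubit Pauli operator `W(v) = W(v₁) ⊗ ⋯ ⊗ W(vₙ)`. -/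
def pauli {n : ℕ} (v : PauliLabel n) : Op n :=
  Matrix.of fun x y => ∏ j, pauli1 (v j) (x j) (y j)

theorem pauli1_00 : pauli1 (0, 0) = !![1, 0; 0, 1] := by simp [pauli1]
theorem pauli1_01 : pauli1 (0, 1) = !![0, 1; 1, 0] := by simp [pauli1]
theorem pauli1_10 : pauli1 (1, 0) = !![1, 0; 0, -1] := by simp [pauli1]
theorem pauli1_11 : pauli1 (1, 1) = !![0, -I; I, 0] := by simp [pauli1]

theorem pauli1_mul (a b : ZMod 2 × ZMod 2) :
    ∃ k : ℕ, pauli1 a * pauli1 b = I ^ k • pauli1 (a + b) := by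
  have hall : ∀ c : ZMod 2 × ZMod 2, c = (0, 0) ∨ c = (0, 1) ∨ c = (1, 0) ∨ c = (1, 1) := by
    decide
  have h2 : (1 : ZMod 2) + 1 = 0 := by decide
  rcases hall a with rfl | rfl | rfl | rfl <;> rcases hall b with rfl | rfl | rfl | rfl <;>
    simp only [Prod.mk_add_mk, add_zero, zero_add, h2, pauli1_00, pauli1_01, pauli1_10,
      pauli1_11] <;>
    first
    | (refine ⟨0, ?_⟩; simp; done)
    | (refine ⟨1, ?_⟩; simp; done)
    | (refine ⟨3, ?_⟩; simp)

theorem pauli_mul {n : ℕ} (u v : PauliLabel n) :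
    ∃ k : ℕ, pauli u * pauli v = I ^ k • pauli (u + v) := by
  choose k hk using fun j => pauli1_mul (u j) (v j)
  refine ⟨∑ j, k j, ?_⟩
  ext x y
  have h : ∀ j, ∑ z, pauli1 (u j) (x j) z * pauli1 (v j) z (y j)
      = I ^ k j * pauli1 (u j + v j) (x j) (y j) := by
    intro j
    have := congrFun (congrFun (hk j) (x j)) (y j)
    simpa [Matrix.mul_apply] using this
  simp only [Matrix.mul_apply, pauli, Matrix.of_apply, Matrix.smul_apply, smul_eq_mul,
    ← Finset.prod_mul_distrib, Pi.add_apply]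
  rw [← Finset.prod_pow_eq_pow_sum, ← Finset.prod_mul_distrib,
    ← Finset.prod_congr rfl (fun j _ => h j), Finset.prod_univ_sum]
  simp [Fintype.piFinset_univ]

theorem pauli_zero {n : ℕ} : pauli (0 : PauliLabel n) = 1 := by
  have h1 : pauli1 0 = 1 := by
    rw [show (0 : ZMod 2 × ZMod 2) = (0, 0) from rfl, pauli1_00, Matrix.one_fin_two]
  ext x y
  simp only [pauli, Matrix.of_apply, Pi.zero_apply, h1, Matrix.one_apply]
  rw [Finset.prod_ite_zero]
  simp [funext_iff]

theorem pauli_add_self {n : ℕ} (v : PauliLabel n) : v + v = 0 := by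
  funext j
  exact Prod.ext (CharTwo.add_self_eq_zero _) (CharTwo.add_self_eq_zero _)

theorem I_pow_mul_pow_three (k : ℕ) : I ^ k * I ^ (3 * k) = 1 := by
  rw [← pow_add, show k + 3 * k = 4 * k by ring, pow_mul, I_pow_four, one_pow]

/-! ### The Clifford group -/

/-- The `n`-qubit Pauli group `{ i ^ a W(v) }`. -/
def pauliGroup (n : ℕ) : Subgroup (UGroup n) where
  carrier := {U | ∃ (a : ℕ) (v : PauliLabel n), (U : Op n) = I ^ a • pauli v}
  one_mem' := ⟨0, 0, by simp [pauli_zero]⟩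
  mul_mem' := by
    rintro U V ⟨a, u, hU⟩ ⟨b, v, hV⟩
    obtain ⟨k, hk⟩ := pauli_mul u v
    refine ⟨a + b + k, u + v, ?_⟩
    simp only [Submonoid.coe_mul, hU, hV, Matrix.smul_mul, Matrix.mul_smul, hk, smul_smul,
      pow_add]
    ring_nf
  inv_mem' := by
    rintro U ⟨a, u, hU⟩
    obtain ⟨k, hk⟩ := pauli_mul u u
    rw [pauli_add_self, pauli_zero] at hk
    refine ⟨3 * a + 3 * k, u, ?_⟩
    have h1 : (I ^ (3 * a + 3 * k) • pauli u) * (U : Op n) = 1 := by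
      rw [hU, Matrix.smul_mul, Matrix.mul_smul, hk, smul_smul, smul_smul, pow_add]
      have : I ^ (3 * a) * I ^ (3 * k) * (I ^ a * I ^ k)
          = (I ^ a * I ^ (3 * a)) * (I ^ k * I ^ (3 * k)) := by ring
      rw [mul_assoc, mul_assoc] at *
      rw [this]
      simp [I_pow_mul_pow_three]
    have h2 : (U : Op n) * ((U⁻¹ : UGroup n) : Op n) = 1 := by
      rw [← Submonoid.coe_mul, mul_inv_cancel]; rfl
    calc ((U⁻¹ : UGroup n) : Op n)
        = (I ^ (3 * a + 3 * k) • pauli u) * (U : Op n) * ((U⁻¹ : UGroup n) : Op n) := by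
          rw [h1, one_mul]
      _ = _ := by rw [mul_assoc, h2, mul_one]

/-- The `n`-qubit Clifford group: the normalizer of the Pauli group in `U(2 ^ n)`.
It contains all global phases. -/
def cliffordGroup (n : ℕ) : Subgroup (UGroup n) :=
  Subgroup.normalizer (pauliGroup n : Set (UGroup n))

/-- The global phases `c • 1` in the Clifford group. -/
def phases (n : ℕ) : Subgroup (cliffordGroup n) where
  carrier := {U | ∃ c : ℂ, ((U : UGroup n) : Op n) = c • 1}
  one_mem' := ⟨1, by simp⟩
  mul_mem' := by
    rintro U V ⟨a, hU⟩ ⟨b, hV⟩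
    exact ⟨a * b, by simp [hU, hV, smul_smul, mul_comm]⟩
  inv_mem' := by
    rintro U ⟨a, hU⟩
    refine ⟨star a, ?_⟩
    change star ((U : UGroup n) : Op n) = _
    rw [hU, star_smul, star_one]

/-- The Clifford group modulo global phases, a finite group of order `4 ^ n * |Sp(2n, 𝔽₂)|`. -/
abbrev Cliff (n : ℕ) : Type := cliffordGroup n ⧸ phases n

theorem finite_pauliGroup (n : ℕ) : Finite (pauliGroup n) := by
  choose a v h using fun U : pauliGroup n => U.2
  refine Finite.of_injective
    (fun U => ((⟨a U % 4, Nat.mod_lt _ (by norm_num)⟩ : Fin 4), v U)) ?_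
  intro U V hUV
  simp only [Prod.mk.injEq, Fin.mk.injEq] at hUV
  apply Subtype.ext
  apply Subtype.ext
  rw [h U, h V, I_pow_eq_pow_mod (a U), I_pow_eq_pow_mod (a V), hUV.1, hUV.2]

/-- An operator that commutes with all Pauli operators is a scalar. -/
theorem eq_smul_one_of_commute_pauli {n : ℕ} (A : Op n)
    (h : ∀ v, pauli v * A = A * pauli v) : ∃ c : ℂ, A = c • 1 := by
  have hdiag : ∀ x y, x ≠ y → A x y = 0 := by
    intro x y hxy
    obtain ⟨j, hj⟩ := Function.ne_iff.mp hxy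
    have hZ : pauli (Pi.single j ((1, 0) : ZMod 2 × ZMod 2) : PauliLabel n)
        = Matrix.diagonal fun x : Bits n => if x j = 0 then (1 : ℂ) else -1 := by
      ext a b
      simp only [pauli, Matrix.of_apply, Matrix.diagonal_apply]
      have hf : ∀ l, pauli1 ((Pi.single j ((1, 0) : ZMod 2 × ZMod 2) : PauliLabel n) l) (a l) (b l)
          = if a l = b l then (if l = j then (if a j = 0 then (1 : ℂ) else -1) else 1) else 0 := by
        intro l
        by_cases hl : l = j
        · subst hl
          rw [Pi.single_eq_same, pauli1_10]
          generalize a l = p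
          generalize b l = q
          fin_cases p <;> fin_cases q <;> simp
        · rw [Pi.single_eq_of_ne hl, show (0 : ZMod 2 × ZMod 2) = (0, 0) from rfl, pauli1_00,
            ← Matrix.one_fin_two, Matrix.one_apply]
          simp [hl]
      rw [Finset.prod_congr rfl (fun l _ => hf l), Finset.prod_ite_zero]
      simp [funext_iff]
    have h1 := congrFun (congrFun (h (Pi.single j ((1, 0) : ZMod 2 × ZMod 2))) x) y
    rw [hZ, Matrix.diagonal_mul, Matrix.mul_diagonal] at h1
    generalize x j = p at hj h1
    generalize y j = q at hj h1
    fin_cases p <;> fin_cases q <;> simp at hj h1 <;>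
      first | linear_combination (1 / 2) * h1 | linear_combination (-1 / 2) * h1
  have hconst : ∀ x y, A x x = A y y := by
    intro x y
    let v : PauliLabel n := fun j => (0, if x j = y j then 0 else 1)
    have hX : ∀ a b, pauli v a b = if (∀ j, (a j = b j ↔ x j = y j)) then (1 : ℂ) else 0 := by
      intro a b
      simp only [pauli, Matrix.of_apply]
      have hf : ∀ l, pauli1 (v l) (a l) (b l)
          = if (a l = b l ↔ x l = y l) then (1 : ℂ) else 0 := by
        intro l
        simp only [v]
        generalize a l = p
        generalize b l = q
        by_cases hl : x l = y l
        · simp only [hl, if_true, pauli1_00]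
          fin_cases p <;> fin_cases q <;> simp
        · simp only [hl, if_false, pauli1_01]
          fin_cases p <;> fin_cases q <;> simp
      rw [Finset.prod_congr rfl (fun l _ => hf l), Finset.prod_ite_zero]
      simp
    have h1 := congrFun (congrFun (h v) x) y
    rw [Matrix.mul_apply, Matrix.mul_apply, Finset.sum_eq_single y, Finset.sum_eq_single x] at h1
    · simpa [hX] using h1.symm
    · intro z _ hz
      rw [hdiag x z (Ne.symm hz), zero_mul]
    · simp
    · intro z _ hz
      rw [hdiag z y hz, mul_zero]
    · simp
  refine ⟨A (fun _ => 0) (fun _ => 0), ?_⟩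
  ext x y
  by_cases hxy : x = y
  · subst hxy; simp [hconst x (fun _ => 0)]
  · simp [hdiag x y hxy, hxy]

theorem pauli1_conjTranspose (a : ZMod 2 × ZMod 2) : (pauli1 a)ᴴ = pauli1 a := by
  have hall : ∀ c : ZMod 2 × ZMod 2, c = (0, 0) ∨ c = (0, 1) ∨ c = (1, 0) ∨ c = (1, 1) := by
    decide
  rcases hall a with rfl | rfl | rfl | rfl <;>
    simp only [pauli1_00, pauli1_01, pauli1_10, pauli1_11] <;>
    ext i j <;> fin_cases i <;> fin_cases j <;> simp

theorem pauli1_mul_self (a : ZMod 2 × ZMod 2) : pauli1 a * pauli1 a = 1 := by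
  have hall : ∀ c : ZMod 2 × ZMod 2, c = (0, 0) ∨ c = (0, 1) ∨ c = (1, 0) ∨ c = (1, 1) := by
    decide
  rcases hall a with rfl | rfl | rfl | rfl <;>
    simp [pauli1_00, pauli1_01, pauli1_10, pauli1_11, Matrix.one_fin_two]

theorem pauli_mem_unitaryGroup {n : ℕ} (v : PauliLabel n) :
    pauli v ∈ Matrix.unitaryGroup (Bits n) ℂ := by
  have hH : star (pauli v) = pauli v := by
    ext x y
    have h1 : ∀ j, star (pauli1 (v j) (y j) (x j)) = pauli1 (v j) (x j) (y j) := fun j =>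
      congrFun (congrFun (pauli1_conjTranspose (v j)) (x j)) (y j)
    simp only [Matrix.star_apply, pauli, Matrix.of_apply, star_prod, h1]
  rw [Matrix.mem_unitaryGroup_iff, hH]
  ext x y
  have h1 : ∀ j, ∑ z, pauli1 (v j) (x j) z * pauli1 (v j) z (y j)
      = (1 : Matrix (Fin 2) (Fin 2) ℂ) (x j) (y j) := fun j => by
    rw [← pauli1_mul_self (v j), Matrix.mul_apply]
  simp only [Matrix.mul_apply, pauli, Matrix.of_apply, ← Finset.prod_mul_distrib]
  have h2 := Finset.prod_univ_sum (fun _ : Fin n => (Finset.univ : Finset (Fin 2)))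
    (fun j z => pauli1 (v j) (x j) z * pauli1 (v j) z (y j))
  rw [Fintype.piFinset_univ] at h2
  rw [← h2, Finset.prod_congr rfl (fun j _ => h1 j)]
  simp only [Matrix.one_apply]
  rw [Finset.prod_ite_zero]
  simp [funext_iff]

theorem finite_cliff (n : ℕ) : Finite (Cliff n) := by
  have := finite_pauliGroup n
  have : Finite (MulAut (pauliGroup n)) :=
    Finite.of_injective (fun f : MulAut (pauliGroup n) => (f : pauliGroup n → pauliGroup n))
      DFunLike.coe_injective
  have hle : (pauliGroup n).normalizerMonoidHom.ker ≤ phases n := by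
    intro U hU
    rw [Subgroup.normalizerMonoidHom_ker, Subgroup.mem_subgroupOf,
      Subgroup.mem_centralizer_iff] at hU
    refine eq_smul_one_of_commute_pauli _ fun v => ?_
    exact congrArg (fun V : UGroup n => (V : Op n))
      (hU ⟨pauli v, pauli_mem_unitaryGroup v⟩ ⟨0, v, by simp⟩)
  have hker := Subgroup.finiteIndex_ker (pauliGroup n).normalizerMonoidHom
  have : (phases n).FiniteIndex := @Subgroup.finiteIndex_of_le _ _ _ _ hker hle
  exact Subgroup.finite_quotient_of_finiteIndex

instance (n : ℕ) : Fintype (Cliff n) :=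
  haveI := finite_cliff n
  Fintype.ofFinite _

/-- A unitary that represents a Clifford operation. All the quantities below depend on it only
through `U ρ U†`, so the choice of the global phase is immaterial. -/
def Cliff.unitary {n : ℕ} (g : Cliff n) : Op n := ((Quotient.out g : cliffordGroup n) : UGroup n)

/-! ### One round of the brickwork circuit with periodic boundary conditions -/

/-- The tensor product of two-qubit operators `A₀, …, A₍ₘ₋₁₎` on `2m` qubits, where `Aᵢ` acts on
the ordered qubit pair `(q (i, 0), q (i, 1))`. -/
def layer {m : ℕ} (q : Fin m × Fin 2 ≃ Fin (m * 2)) (A : Fin m → Op 2) : Op (m * 2) :=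
  Matrix.of fun x y => ∏ i, A i (fun j => x (q (i, j))) (fun j => y (q (i, j)))

/-- First layer: with qubits counted from `0`, brick `i` acts on the pair `(2i, 2i + 1)`. -/
def firstPairs (m : ℕ) : Fin m × Fin 2 ≃ Fin (m * 2) := finProdFinEquiv

/-- Second layer: with qubits counted from `0`, brick `i` acts on the pair `(2i + 1, 2i + 2)`,
where qubit `2m` is identified with qubit `0`. -/
def secondPairs (m : ℕ) : Fin m × Fin 2 ≃ Fin (m * 2) :=
  finProdFinEquiv.trans (finRotate (m * 2))

/-- The choices of all bricks (first layer, second layer) of the circuit on `2m` qubits.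
The random circuit is uniformly distributed on this finite set, that is, all bricks are
independent and uniformly random Clifford operations. -/
abbrev Circuit (m : ℕ) : Type := (Fin m → Cliff 2) × (Fin m → Cliff 2)

/-- The unitary of the circuit; the first layer acts first. -/
def Circuit.unitary {m : ℕ} (c : Circuit m) : Op (m * 2) :=
  layer (secondPairs m) (fun i => (c.2 i).unitary) *
    layer (firstPairs m) (fun i => (c.1 i).unitary)

/-! ### Shadow estimation -/

/-- The Hilbert–Schmidt inner product `(A|B) = Tr(A† B)`. -/
def hs {n : ℕ} (A B : Op n) : ℂ := (Aᴴ * B).trace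

/-- The superoperator `|A)(B| : C ↦ (B|C) A`. -/
def outer {n : ℕ} (A B : Op n) : Op n →ₗ[ℂ] Op n where
  toFun C := hs B C • A
  map_add' C D := by simp [hs, Matrix.mul_add, add_smul]
  map_smul' r C := by simp [hs, smul_smul]

/-- The effect `E_{i,U} = U† |i⟩⟨i| U`. -/
def effect {m : ℕ} (i : Bits (m * 2)) (c : Circuit m) : Op (m * 2) :=
  c.unitaryᴴ * Matrix.single i i 1 * c.unitary

/-- The frame operator (measurement channel) `S = ∑ᵢ 𝔼_U |E_{i,U})(E_{i,U}|`. -/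
def frameOp (m : ℕ) : Module.End ℂ (Op (m * 2)) :=
  ∑ i, 𝔼 c : Circuit m, outer (effect i c) (effect i c)

/-- The diagonal matrix element `(v|S|v)` in the normalized Pauli basis `|v) = 2 ^ (-n/2) W(v)`. -/
def diagEntry {n : ℕ} (S : Module.End ℂ (Op n)) (v : PauliLabel n) : ℂ :=
  hs (pauli v) (S (pauli v)) / 2 ^ n

/-- The estimator `f_O(i,U) = (O|S⁻¹(E_{i,U}))` given by the canonical dual frame. -/
def estimator {m : ℕ} (O : Op (m * 2)) (i : Bits (m * 2)) (c : Circuit m) : ℂ :=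
  hs O (Ring.inverse (frameOp m) (effect i c))

/-- Density operators. -/
def IsState {n : ℕ} (ρ : Op n) : Prop := ρ.PosSemidef ∧ ρ.trace = 1

/-- The second moment of a single sample of the estimator of `W(v)` in the state `ρ`:
the circuit `U` is drawn at random and the outcome `i` has probability `(E_{i,U}|ρ)`. -/
def secondMoment {m : ℕ} (v : PauliLabel (m * 2)) (ρ : Op (m * 2)) : ℂ :=
  ∑ i, 𝔼 c : Circuit m, estimator (pauli v) i c ^ 2 * hs (effect i c) ρ

/-- The variance of a single sample of the estimator of `W(v)` in the state `ρ`. -/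
def variance {m : ℕ} (v : PauliLabel (m * 2)) (ρ : Op (m * 2)) : ℂ :=
  secondMoment v ρ - hs (pauli v) ρ ^ 2

end BrickworkShadows

end

noncomputable section
namespace BrickworkShadows

/-! ### Pauli algebra -/

theorem label_cases (c : ZMod 2 × ZMod 2) :
    c = (0, 0) ∨ c = (0, 1) ∨ c = (1, 0) ∨ c = (1, 1) := by
  revert c; decide

theorem pauli_conjTranspose {n : ℕ} (v : PauliLabel n) : (pauli v)ᴴ = pauli v := by
  ext x y
  have h1 : ∀ j, star (pauli1 (v j) (y j) (x j)) = pauli1 (v j) (x j) (y j) := fun j =>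
    congrFun (congrFun (pauli1_conjTranspose (v j)) (x j)) (y j)
  simp only [Matrix.conjTranspose_apply, pauli, Matrix.of_apply, star_prod, h1]

theorem pauli_mul_self {n : ℕ} (v : PauliLabel n) : pauli v * pauli v = 1 := by
  have h := Matrix.mem_unitaryGroup_iff.mp (pauli_mem_unitaryGroup v)
  rwa [Matrix.star_eq_conjTranspose, pauli_conjTranspose] at h

theorem pauli_mul_apply {n : ℕ} (u v : PauliLabel n) (x y : Bits n) :
    (pauli u * pauli v) x y = ∏ j, (pauli1 (u j) * pauli1 (v j)) (x j) (y j) := by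
  simp only [Matrix.mul_apply, pauli, Matrix.of_apply, ← Finset.prod_mul_distrib]
  rw [Finset.prod_univ_sum, Fintype.piFinset_univ]

/-- The sign with which two single-qubit Pauli operators commute. -/
def commSign (a b : ZMod 2 × ZMod 2) : ℂ := if a.1 * b.2 + a.2 * b.1 = 0 then 1 else -1

theorem commSign_eq_or (a b : ZMod 2 × ZMod 2) : commSign a b = 1 ∨ commSign a b = -1 := by
  unfold commSign; split_ifs <;> simp

theorem pauli1_comm (a b : ZMod 2 × ZMod 2) :
    pauli1 a * pauli1 b = commSign a b • (pauli1 b * pauli1 a) := by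
  have h2 : (1 : ZMod 2) + 1 = 0 := by decide
  rcases label_cases a with rfl | rfl | rfl | rfl <;>
    rcases label_cases b with rfl | rfl | rfl | rfl <;>
    simp [commSign, h2, pauli1_00, pauli1_01, pauli1_10, pauli1_11]

theorem pauli_comm {n : ℕ} (u v : PauliLabel n) :
    pauli u * pauli v = (∏ j, commSign (u j) (v j)) • (pauli v * pauli u) := by
  ext x y
  rw [Matrix.smul_apply, pauli_mul_apply, pauli_mul_apply, smul_eq_mul, ← Finset.prod_mul_distrib]
  refine Finset.prod_congr rfl fun j _ => ?_
  rw [pauli1_comm, Matrix.smul_apply, smul_eq_mul]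

theorem pauli_comm_or {n : ℕ} (u v : PauliLabel n) :
    pauli u * pauli v = pauli v * pauli u ∨ pauli u * pauli v = -(pauli v * pauli u) := by
  have h : (∏ j, commSign (u j) (v j)) = 1 ∨ (∏ j, commSign (u j) (v j)) = -1 := by
    refine Finset.prod_induction _ (fun z : ℂ => z = 1 ∨ z = -1) ?_ (Or.inl rfl)
      fun j _ => commSign_eq_or _ _
    rintro _ _ (rfl | rfl) (rfl | rfl) <;> simp
  rw [pauli_comm]
  rcases h with h | h <;> simp [h]

/-- The diagonal of a Pauli operator of `Z` type consists of signs. -/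
theorem pauli_diag_sq_of_zType {n : ℕ} {v : PauliLabel n} (hv : ∀ j, (v j).2 = 0) (x : Bits n) :
    pauli v x x ^ 2 = 1 := by
  simp only [pauli, Matrix.of_apply, ← Finset.prod_pow]
  refine Finset.prod_eq_one fun j _ => ?_
  have h := hv j
  generalize v j = a at h
  generalize x j = p
  rcases label_cases a with rfl | rfl | rfl | rfl <;> simp at h <;> fin_cases p <;>
    simp [pauli1_00, pauli1_10]

theorem pauli_offDiag_of_zType {n : ℕ} {v : PauliLabel n} (hv : ∀ j, (v j).2 = 0) {x y : Bits n}
    (hxy : x ≠ y) : pauli v x y = 0 := by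
  obtain ⟨j, hj⟩ := Function.ne_iff.mp hxy
  refine Finset.prod_eq_zero (Finset.mem_univ j) ?_
  have h := hv j
  generalize v j = a at h
  generalize x j = p at hj
  generalize y j = q at hj
  rcases label_cases a with rfl | rfl | rfl | rfl <;> simp at h <;> fin_cases p <;>
    fin_cases q <;> simp [pauli1_00, pauli1_10] at hj ⊢

theorem pauli_diag_of_not_zType {n : ℕ} {v : PauliLabel n} (hv : ¬ ∀ j, (v j).2 = 0)
    (x : Bits n) : pauli v x x = 0 := by
  obtain ⟨j, hj⟩ := not_forall.mp hv
  refine Finset.prod_eq_zero (Finset.mem_univ j) ?_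
  generalize v j = a at hj
  generalize x j = p
  rcases label_cases a with rfl | rfl | rfl | rfl <;> simp at hj <;> fin_cases p <;>
    simp [pauli1_01, pauli1_11]

theorem single_eq_sum_pauli {n : ℕ} (x y : Bits n) :
    (Matrix.single x y 1 : Op n) =
      ∑ v : PauliLabel n, (∏ j, pauli1 (v j) (y j) (x j) / 2) • pauli v := by
  have h1 : ∀ a b k l : Fin 2, ∑ p : ZMod 2 × ZMod 2, pauli1 p b a / 2 * pauli1 p k l
      = if a = k ∧ b = l then 1 else 0 := by
    intro a b k l
    rw [Fintype.sum_prod_type, show (Finset.univ : Finset (ZMod 2)) = {0, 1} from rfl]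
    fin_cases a <;> fin_cases b <;> fin_cases k <;> fin_cases l <;>
      simp [pauli1_00, pauli1_01, pauli1_10, pauli1_11] <;> ring_nf <;> norm_num
  ext k l
  simp only [Matrix.sum_apply, Matrix.smul_apply, smul_eq_mul, pauli, Matrix.of_apply,
    ← Finset.prod_mul_distrib]
  rw [← Fintype.piFinset_univ, ← Finset.prod_univ_sum (fun _ => Finset.univ)
    (fun j p => pauli1 p (y j) (x j) / 2 * pauli1 p (k j) (l j))]
  simp only [h1, Matrix.single_apply]
  rw [Finset.prod_ite_zero]
  simp [funext_iff, forall_and]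

theorem span_pauli (n : ℕ) : Submodule.span ℂ (Set.range (pauli : PauliLabel n → Op n)) = ⊤ := by
  rw [eq_top_iff]
  rintro A -
  rw [Matrix.matrix_eq_sum_single A]
  refine Submodule.sum_mem _ fun x _ => Submodule.sum_mem _ fun y _ => ?_
  rw [show Matrix.single x y (A x y) = A x y • (Matrix.single x y 1 : Op n) by simp,
    single_eq_sum_pauli]
  exact Submodule.smul_mem _ _ (Submodule.sum_mem _ fun v _ =>
    Submodule.smul_mem _ _ (Submodule.subset_span ⟨v, rfl⟩))

/-! ### Clifford operations -/

theorem Cliff.conj_pauli {n : ℕ} (g : Cliff n) (v : PauliLabel n) :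
    ∃ (a : ℕ) (w : PauliLabel n), g.unitary * pauli v * g.unitaryᴴ = I ^ a • pauli w :=
  (Subgroup.mem_normalizer_iff.mp (Quotient.out g).2 ⟨pauli v, pauli_mem_unitaryGroup v⟩).mp
    ⟨0, v, by simp⟩

theorem Cliff.unitary_mem {n : ℕ} (g : Cliff n) :
    g.unitary ∈ Matrix.unitaryGroup (Bits n) ℂ := (Quotient.out g : cliffordGroup n).1.2

/-- Conjugation by the representative of a class agrees with conjugation by any element of it. -/
theorem Cliff.conj_mk {n : ℕ} (g : cliffordGroup n) (A : Op n) :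
    Cliff.unitary (QuotientGroup.mk g : Cliff n) * A *
      (Cliff.unitary (QuotientGroup.mk g : Cliff n))ᴴ = ((g : UGroup n) : Op n) * A *
        ((g : UGroup n) : Op n)ᴴ := by
  obtain ⟨⟨h, c, hc⟩, hout⟩ := QuotientGroup.mk_out_eq_mul (phases n) g
  have hu : Cliff.unitary (QuotientGroup.mk g : Cliff n) = c • ((g : UGroup n) : Op n) := by
    unfold Cliff.unitary
    rw [hout]
    simp only [Subgroup.coe_mul, Submonoid.coe_mul, hc]
    simp
  have hcc : c * star c = 1 := by
    have h1 := Matrix.mem_unitaryGroup_iff'.mp (h : UGroup n).2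
    rw [hc] at h1
    have := congrFun (congrFun h1 0) 0
    simpa [Matrix.star_eq_conjTranspose, mul_comm] using this
  rw [hu, Matrix.conjTranspose_smul, Matrix.smul_mul, Matrix.smul_mul, Matrix.mul_smul, smul_smul,
    hcc, one_smul]

/-- The Hermitian Clifford unitary `(W(u) + W(w)) / √2` for anticommuting `W(u)` and `W(w)`. -/
theorem exists_cliff_conj_eq {n : ℕ} {u w : PauliLabel n}
    (h : pauli u * pauli w = -(pauli w * pauli u)) :
    ∃ g : Cliff n, g.unitary * pauli u * g.unitaryᴴ = pauli w := by
  set A := pauli u with hA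
  set B := pauli w with hB
  have hAA : A * A = 1 := pauli_mul_self u
  have hBB : B * B = 1 := pauli_mul_self w
  obtain ⟨s, hs, hss⟩ : ∃ s : ℂ, star s = s ∧ s * s = 1 / 2 := by
    refine ⟨((Real.sqrt (1 / 2) : ℝ) : ℂ), Complex.conj_ofReal _, ?_⟩
    rw [← Complex.ofReal_mul, Real.mul_self_sqrt (by norm_num)]
    norm_num
  set H : Op n := s • (A + B) with hH
  have hHH : Hᴴ = H := by
    rw [hH, Matrix.conjTranspose_smul, Matrix.conjTranspose_add, hs, hA, hB, pauli_conjTranspose,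
      pauli_conjTranspose]
  have conj : ∀ P : Op n, H * P * H = (1 / 2 : ℂ) • ((A + B) * P * (A + B)) := fun P => by
    rw [hH, Matrix.smul_mul, Matrix.smul_mul, Matrix.mul_smul, smul_smul, hss]
  have half : ∀ P : Op n, (1 / 2 : ℂ) • (P + P) = P := fun P => by
    rw [← two_smul ℂ P, smul_smul]; norm_num
  have hH2 : H * H = 1 := by
    have := conj 1
    rw [mul_one, mul_one] at this
    rw [this, add_mul, mul_add, mul_add, hAA, hBB, h, ← half 1]
    congr 1
    rw [half 1]
    abel
  have key : ∀ p : PauliLabel n, ∃ (a : ℕ) (q : PauliLabel n),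
      H * pauli p * H = I ^ a • pauli q := by
    intro p
    obtain ⟨k, hk⟩ := pauli_mul w u
    obtain ⟨l, hl⟩ := pauli_mul (w + u) p
    have hBA : B * A * pauli p = I ^ (k + l) • pauli (w + u + p) := by
      rw [hB, hA, hk, Matrix.smul_mul, hl, smul_smul, pow_add]
    have neg : ∀ (a : ℕ) (q : PauliLabel n), -(I ^ a • pauli q) = I ^ (a + 2) • pauli q := by
      intro a q
      rw [pow_add, I_sq, mul_neg_one, neg_smul]
    have hPH : ∀ P : Op n, (A + B) * P = P * (A + B) → H * P * H = P := by
      intro P hP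
      have : H * P = P * H := by rw [hH, Matrix.smul_mul, hP, Matrix.mul_smul]
      rw [this, mul_assoc, hH2, mul_one]
    have hPH' : ∀ P : Op n, (A + B) * P = -(P * (A + B)) → H * P * H = -P := by
      intro P hP
      have : H * P = -(P * H) := by rw [hH, Matrix.smul_mul, hP, Matrix.mul_smul, smul_neg]
      rw [this, neg_mul, mul_assoc, hH2, mul_one]
    rcases pauli_comm_or u p with h1 | h1 <;> rcases pauli_comm_or w p with h2 | h2 <;>
      rw [← hA] at h1 <;> rw [← hB] at h2
    · exact ⟨0, p, by rw [hPH _ (by rw [add_mul, h1, h2, mul_add])]; simp⟩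
    · refine ⟨k + l, w + u + p, ?_⟩
      rw [← hBA, conj, mul_assoc, show pauli p * (A + B) = (A - B) * pauli p by
        rw [sub_mul, h1, h2, mul_add]; abel, ← mul_assoc, ← half (B * A * pauli p)]
      rw [show (A + B) * (A - B) = B * A + B * A by
        rw [add_mul, mul_sub, mul_sub, hAA, hBB, h]; abel, add_mul]
    · refine ⟨k + l + 2, w + u + p, ?_⟩
      rw [← neg, ← hBA, conj, mul_assoc, show pauli p * (A + B) = (B - A) * pauli p by
        rw [sub_mul, h1, h2, mul_add]; abel, ← mul_assoc, ← half (-(B * A * pauli p))]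
      rw [show (A + B) * (B - A) = -(B * A) + -(B * A) by
        rw [add_mul, mul_sub, mul_sub, hAA, hBB, h]; abel, add_mul, neg_mul]
    · refine ⟨0 + 2, p, ?_⟩
      rw [← neg, hPH' _ (by rw [add_mul, h1, h2, mul_add]; abel)]
      simp
  have hmem : H ∈ Matrix.unitaryGroup (Bits n) ℂ := by
    rw [Matrix.mem_unitaryGroup_iff, Matrix.star_eq_conjTranspose, hHH, hH2]
  let G : UGroup n := ⟨H, hmem⟩
  have hGi : ((G⁻¹ : UGroup n) : Op n) = H := hHH
  have fwd : ∀ V : UGroup n, V ∈ pauliGroup n → G * V * G⁻¹ ∈ pauliGroup n := by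
    rintro V ⟨a, v, hV⟩
    obtain ⟨b, q, hq⟩ := key v
    refine ⟨a + b, q, ?_⟩
    rw [Submonoid.coe_mul, Submonoid.coe_mul, hGi, hV]
    change H * _ * H = _
    rw [Matrix.mul_smul H, Matrix.smul_mul, hq, smul_smul, pow_add]
  have hGG : G⁻¹ = G := Subtype.ext hGi
  have hG : G ∈ cliffordGroup n := by
    refine Subgroup.mem_normalizer_iff.mpr fun V => ⟨fwd V, fun hV => ?_⟩
    have := fwd _ hV
    have hGG' : G * G = 1 := by nth_rw 1 [← hGG]; exact inv_mul_cancel G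
    rwa [hGG, show G * (G * V * G) * G = G * G * V * (G * G) by simp only [mul_assoc], hGG',
      one_mul, mul_one] at this
  refine ⟨QuotientGroup.mk ⟨G, hG⟩, ?_⟩
  rw [Cliff.conj_mk]
  change H * A * Hᴴ = B
  rw [hHH, conj, mul_assoc, show A * (A + B) = (A + B) * B by
    rw [add_mul, mul_add, hAA, hBB, add_comm], ← mul_assoc, ← half B]
  congr 1
  rw [half B, show (A + B) * (A + B) = 1 + 1 by
    rw [add_mul, mul_add, mul_add, hAA, hBB, h]; abel, add_mul, one_mul]

/-- Every Pauli operator is mapped to one of `Z` type by some Clifford operation. -/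
theorem exists_cliff_conj_zType {n : ℕ} (w : PauliLabel n) :
    ∃ (g : Cliff n) (z : PauliLabel n),
      (∀ j, (z j).2 = 0) ∧ g.unitary * pauli w * g.unitaryᴴ = pauli z := by
  by_cases hw : ∀ j, (w j).2 = 0
  · exact ⟨QuotientGroup.mk 1, w, hw, by rw [Cliff.conj_mk]; simp⟩
  · obtain ⟨j, hj⟩ := not_forall.mp hw
    have hj1 : (w j).2 = 1 := by
      revert hj; generalize (w j).2 = a; revert a; decide
    let z : PauliLabel n := Pi.single j (1, 0)
    have hanti : pauli w * pauli z = -(pauli z * pauli w) := by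
      rw [pauli_comm, Finset.prod_eq_single j]
      · simp [z, commSign, hj1]
      · intro l _ hl
        simp [z, hl, commSign]
      · simp
    obtain ⟨g, hg⟩ := exists_cliff_conj_eq hanti
    refine ⟨g, z, fun l => ?_, hg⟩
    by_cases hl : l = j
    · subst hl; simp [z]
    · simp [z, hl]

/-! ### Layers -/

theorem layer_mul {m : ℕ} (q : Fin m × Fin 2 ≃ Fin (m * 2)) (A B : Fin m → Op 2) :
    layer q A * layer q B = layer q (fun i => A i * B i) := by
  let e : (Fin m → Bits 2) ≃ Bits (m * 2) :=
    (Equiv.curry (Fin m) (Fin 2) (Fin 2)).symm.trans (q.arrowCongr (Equiv.refl _))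
  have he : ∀ f i j, e f (q (i, j)) = f i j := fun f i j => by simp [e, Function.uncurry]
  ext x y
  simp only [Matrix.mul_apply, layer, Matrix.of_apply, ← Finset.prod_mul_distrib]
  rw [Finset.prod_univ_sum, Fintype.piFinset_univ, ← e.sum_comp]
  simp only [he]

theorem layer_conjTranspose {m : ℕ} (q : Fin m × Fin 2 ≃ Fin (m * 2)) (A : Fin m → Op 2) :
    (layer q A)ᴴ = layer q (fun i => (A i)ᴴ) := by
  ext x y
  simp [layer, Matrix.conjTranspose_apply]

theorem layer_smul {m : ℕ} (q : Fin m × Fin 2 ≃ Fin (m * 2)) (s : Fin m → ℂ) (A : Fin m → Op 2) :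
    layer q (fun i => s i • A i) = (∏ i, s i) • layer q A := by
  ext x y
  simp [layer, Finset.prod_mul_distrib]

theorem layer_pauli {m : ℕ} (q : Fin m × Fin 2 ≃ Fin (m * 2)) (v : PauliLabel (m * 2)) :
    layer q (fun i => pauli fun j => v (q (i, j))) = pauli v := by
  ext x y
  simp only [layer, pauli, Matrix.of_apply]
  rw [← q.prod_comp, Fintype.prod_prod_type]

theorem layer_one {m : ℕ} (q : Fin m × Fin 2 ≃ Fin (m * 2)) :
    layer q (fun _ => 1) = 1 := by
  simpa [Pi.zero_def, ← pauli_zero] using layer_pauli q 0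

theorem layer_conj_pauli {m : ℕ} (q : Fin m × Fin 2 ≃ Fin (m * 2)) (A : Fin m → Op 2)
    (v w : PauliLabel (m * 2)) (s : Fin m → ℂ)
    (h : ∀ i, A i * pauli (fun j => v (q (i, j))) * (A i)ᴴ = s i • pauli fun j => w (q (i, j))) :
    layer q A * pauli v * (layer q A)ᴴ = (∏ i, s i) • pauli w := by
  rw [← layer_pauli q v, layer_conjTranspose, layer_mul, layer_mul, ← layer_pauli q w,
    ← layer_smul]
  simp only [h]

theorem layer_cliff_conj_pauli {m : ℕ} (q : Fin m × Fin 2 ≃ Fin (m * 2)) (g : Fin m → Cliff 2)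
    (v : PauliLabel (m * 2)) : ∃ (a : ℕ) (w : PauliLabel (m * 2)),
      layer q (fun i => (g i).unitary) * pauli v * (layer q fun i => (g i).unitary)ᴴ =
        I ^ a • pauli w := by
  choose a w h using fun i => (g i).conj_pauli fun j => v (q (i, j))
  refine ⟨∑ i, a i, fun k => w (q.symm k).1 (q.symm k).2, ?_⟩
  rw [← Finset.prod_pow_eq_pow_sum]
  exact layer_conj_pauli q _ _ _ _ fun i => by simpa using h i

theorem layer_cliff_unitary {m : ℕ} (q : Fin m × Fin 2 ≃ Fin (m * 2)) (g : Fin m → Cliff 2) :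
    (layer q fun i => (g i).unitary)ᴴ * layer q (fun i => (g i).unitary) = 1 := by
  rw [layer_conjTranspose, layer_mul, ← layer_one q]
  congr 1
  funext i
  exact Matrix.mem_unitaryGroup_iff'.mp (g i).unitary_mem

/-! ### Circuits -/

theorem Circuit.unitary_conjTranspose_mul {m : ℕ} (c : Circuit m) :
    c.unitaryᴴ * c.unitary = 1 := by
  rw [Circuit.unitary, Matrix.conjTranspose_mul, mul_assoc, ← mul_assoc _ _ (layer (firstPairs m) _),
    layer_cliff_unitary, one_mul, layer_cliff_unitary]

theorem Circuit.unitary_mul_conjTranspose {m : ℕ} (c : Circuit m) :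
    c.unitary * c.unitaryᴴ = 1 :=
  mul_eq_one_comm.mp c.unitary_conjTranspose_mul

/-- The Pauli operator `W(v)` in the Heisenberg picture, `U W(v) U†`. -/
def Circuit.conj {m : ℕ} (c : Circuit m) (v : PauliLabel (m * 2)) : Op (m * 2) :=
  c.unitary * pauli v * c.unitaryᴴ

theorem Circuit.conj_eq {m : ℕ} (c : Circuit m) (v : PauliLabel (m * 2)) :
    ∃ (a : ℕ) (w : PauliLabel (m * 2)), c.conj v = I ^ a • pauli w := by
  obtain ⟨a, u, hu⟩ := layer_cliff_conj_pauli (firstPairs m) c.1 v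
  obtain ⟨b, w, hw⟩ := layer_cliff_conj_pauli (secondPairs m) c.2 u
  refine ⟨a + b, w, ?_⟩
  rw [Circuit.conj, Circuit.unitary, Matrix.conjTranspose_mul]
  calc _ = layer (secondPairs m) (fun i => (c.2 i).unitary) *
        (layer (firstPairs m) (fun i => (c.1 i).unitary) * pauli v *
          (layer (firstPairs m) fun i => (c.1 i).unitary)ᴴ) *
        (layer (secondPairs m) fun i => (c.2 i).unitary)ᴴ := by simp only [mul_assoc]
    _ = _ := by rw [hu, Matrix.mul_smul, Matrix.smul_mul, hw, smul_smul, pow_add]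

theorem Circuit.conj_mul_self {m : ℕ} (c : Circuit m) (v : PauliLabel (m * 2)) :
    c.conj v * c.conj v = 1 := by
  calc c.conj v * c.conj v
      = c.unitary * (pauli v * (c.unitaryᴴ * c.unitary) * pauli v) * c.unitaryᴴ := by
        simp only [Circuit.conj, mul_assoc]
    _ = 1 := by rw [c.unitary_conjTranspose_mul, mul_one, pauli_mul_self, mul_one,
        c.unitary_mul_conjTranspose]

/-- A circuit maps `W(v)` either to a signed Pauli operator of `Z` type or to an operator with
zero diagonal. -/
theorem Circuit.conj_diag {m : ℕ} (c : Circuit m) (v : PauliLabel (m * 2)) :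
    ∃ e : ℂ, (e = 0 ∨ e = 1) ∧ (∀ i, c.conj v i i ^ 2 = e) ∧
      Matrix.diagonal (fun i => c.conj v i i) = e • c.conj v := by
  obtain ⟨a, w, h⟩ := c.conj_eq v
  have ha : (I ^ a) ^ 2 = 1 := by
    have h2 := c.conj_mul_self v
    rw [h, Matrix.smul_mul, Matrix.mul_smul, pauli_mul_self, smul_smul] at h2
    have := congrFun (congrFun h2 0) 0
    simpa [sq] using this
  by_cases hw : ∀ j, (w j).2 = 0
  · refine ⟨1, Or.inr rfl, fun i => ?_, ?_⟩
    · rw [h, Matrix.smul_apply, smul_eq_mul, mul_pow, ha, pauli_diag_sq_of_zType hw, one_mul]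
    · ext x y
      rw [one_smul, Matrix.diagonal_apply]
      split_ifs with hxy
      · rw [hxy]
      · rw [h, Matrix.smul_apply, pauli_offDiag_of_zType hw hxy, smul_zero]
  · have hd : ∀ i, c.conj v i i = 0 := fun i => by
      rw [h, Matrix.smul_apply, pauli_diag_of_not_zType hw, smul_zero]
    exact ⟨0, Or.inl rfl, by simp [hd], by simp [hd]⟩

/-- The indicator of the event that the circuit maps `W(v)` to an operator of `Z` type. -/
def Circuit.hit {m : ℕ} (c : Circuit m) (v : PauliLabel (m * 2)) : ℂ := (c.conj_diag v).choose

theorem Circuit.hit_eq_or {m : ℕ} (c : Circuit m) (v : PauliLabel (m * 2)) :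
    c.hit v = 0 ∨ c.hit v = 1 := (c.conj_diag v).choose_spec.1

theorem Circuit.conj_diag_sq {m : ℕ} (c : Circuit m) (v : PauliLabel (m * 2)) (i : Bits (m * 2)) :
    c.conj v i i ^ 2 = c.hit v := (c.conj_diag v).choose_spec.2.1 i

theorem Circuit.diagonal_conj {m : ℕ} (c : Circuit m) (v : PauliLabel (m * 2)) :
    Matrix.diagonal (fun i => c.conj v i i) = c.hit v • c.conj v := (c.conj_diag v).choose_spec.2.2

theorem exists_hit_ne_zero {m : ℕ} (v : PauliLabel (m * 2)) : ∃ c : Circuit m, c.hit v ≠ 0 := by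
  choose g z hz hg using fun i => exists_cliff_conj_zType fun j => v (firstPairs m (i, j))
  let w : PauliLabel (m * 2) := fun k => z ((firstPairs m).symm k).1 ((firstPairs m).symm k).2
  have h1 := layer_conj_pauli (firstPairs m) (fun i => (g i).unitary) v w (fun _ => 1)
    fun i => by simpa [w] using hg i
  have h2 := layer_conj_pauli (secondPairs m)
    (fun _ => Cliff.unitary (QuotientGroup.mk 1 : Cliff 2)) w w (fun _ => 1)
    fun i => by rw [Cliff.conj_mk]; simp
  let c : Circuit m := (g, fun _ => QuotientGroup.mk 1)
  have h : c.conj v = pauli w := by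
    rw [Circuit.conj, Circuit.unitary, Matrix.conjTranspose_mul]
    calc _ = layer (secondPairs m) (fun i => (c.2 i).unitary) *
          (layer (firstPairs m) (fun i => (c.1 i).unitary) * pauli v *
            (layer (firstPairs m) fun i => (c.1 i).unitary)ᴴ) *
          (layer (secondPairs m) fun i => (c.2 i).unitary)ᴴ := by simp only [mul_assoc]
      _ = pauli w := by
        rw [h1, Finset.prod_const_one, one_smul, h2, Finset.prod_const_one, one_smul]
  refine ⟨c, ?_⟩
  rw [← c.conj_diag_sq v 0, h, pauli_diag_sq_of_zType fun _ => hz _ _]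
  exact one_ne_zero

/-! ### The frame operator -/

theorem effect_conjTranspose {m : ℕ} (i : Bits (m * 2)) (c : Circuit m) :
    (effect i c)ᴴ = effect i c := by
  simp [effect, Matrix.conjTranspose_mul, Matrix.conjTranspose_single, mul_assoc]

theorem sum_effect {m : ℕ} (c : Circuit m) : ∑ i, effect i c = 1 := by
  simp only [effect]
  rw [← Finset.sum_mul, ← Finset.mul_sum, Matrix.sum_single_one, mul_one,
    c.unitary_conjTranspose_mul]

theorem hs_pauli_effect {m : ℕ} (v : PauliLabel (m * 2)) (i : Bits (m * 2)) (c : Circuit m) :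
    hs (pauli v) (effect i c) = c.conj v i i := by
  rw [hs, pauli_conjTranspose, effect, Matrix.mul_assoc, ← Matrix.mul_assoc, Matrix.trace_mul_comm,
    Matrix.mul_assoc, ← Matrix.mul_assoc c.unitary, ← Circuit.conj, Matrix.trace_single_mul]
  simp

theorem star_hs {n : ℕ} (A B : Op n) : star (hs A B) = hs B A := by
  rw [hs, hs, ← Matrix.trace_conjTranspose, Matrix.conjTranspose_mul,
    Matrix.conjTranspose_conjTranspose]

theorem hs_effect_pauli {m : ℕ} (v : PauliLabel (m * 2)) (i : Bits (m * 2)) (c : Circuit m) :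
    hs (effect i c) (pauli v) = c.conj v i i := by
  rw [← hs_pauli_effect, hs, hs, effect_conjTranspose, pauli_conjTranspose, Matrix.trace_mul_comm]

theorem sum_outer_effect_pauli {m : ℕ} (v : PauliLabel (m * 2)) (c : Circuit m) :
    ∑ i, outer (effect i c) (effect i c) (pauli v) = c.hit v • pauli v := by
  calc ∑ i, outer (effect i c) (effect i c) (pauli v)
      = ∑ i, c.unitaryᴴ * Matrix.single i i (c.conj v i i) * c.unitary := by
        refine Finset.sum_congr rfl fun i _ => ?_
        change hs (effect i c) (pauli v) • effect i c = _
        rw [hs_effect_pauli, effect, ← Matrix.smul_mul, ← Matrix.mul_smul, Matrix.smul_single,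
         
          smul_eq_mul, mul_one]
    _ = c.unitaryᴴ * (c.hit v • c.conj v) * c.unitary := by
        rw [← Finset.sum_mul, ← Finset.mul_sum, ← c.diagonal_conj]
        congr 2
        ext x y
        simp [Matrix.sum_apply, Matrix.single_apply, Matrix.diagonal_apply, ite_and]
    _ = c.hit v • (c.unitaryᴴ * c.unitary * pauli v * (c.unitaryᴴ * c.unitary)) := by
        rw [Matrix.mul_smul, Matrix.smul_mul, Circuit.conj]; simp only [mul_assoc]
    _ = c.hit v • pauli v := by rw [c.unitary_conjTranspose_mul, one_mul, mul_one]

/-- The probability that the random circuit maps `W(v)` to an operator of `Z` type. -/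
def hitProb {m : ℕ} (v : PauliLabel (m * 2)) : ℂ := 𝔼 c : Circuit m, c.hit v

theorem frameOp_apply {m : ℕ} (A : Op (m * 2)) :
    frameOp m A = (Fintype.card (Circuit m) : ℂ)⁻¹ •
      ∑ c : Circuit m, ∑ i, hs (effect i c) A • effect i c := by
  have h : frameOp m = (Fintype.card (Circuit m) : ℂ)⁻¹ •
      ∑ c : Circuit m, ∑ i, outer (effect i c) (effect i c) := by
    rw [frameOp, ← Finset.expect_sum_comm, Finset.expect, ← NNRat.cast_smul_eq_nnqsmul ℂ]
    simp
  rw [h]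
  simp only [LinearMap.smul_apply, LinearMap.sum_apply]
  rfl

theorem frameOp_pauli {m : ℕ} (v : PauliLabel (m * 2)) :
    frameOp m (pauli v) = hitProb v • pauli v := by
  rw [frameOp_apply, hitProb, Fintype.expect_eq_sum_div_card, div_eq_inv_mul, mul_smul,
    Finset.sum_smul]
  exact congrArg _ (Finset.sum_congr rfl fun c _ => sum_outer_effect_pauli v c)

theorem hitProb_pos {m : ℕ} (v : PauliLabel (m * 2)) : 0 < hitProb v := by
  have hnn : ∀ c : Circuit m, 0 ≤ c.hit v := fun c => by
    rcases c.hit_eq_or v with h | h <;> simp [h]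
  obtain ⟨c, hc⟩ := exists_hit_ne_zero v
  exact Finset.expect_pos' (fun c _ => hnn c) ⟨c, Finset.mem_univ c, lt_of_le_of_ne (hnn c) hc.symm⟩

theorem hs_pauli_self {n : ℕ} (v : PauliLabel n) : hs (pauli v) (pauli v) = 2 ^ n := by
  rw [hs, pauli_conjTranspose, pauli_mul_self, Matrix.trace_one]
  simp

theorem diagEntry_frameOp {m : ℕ} (v : PauliLabel (m * 2)) :
    diagEntry (frameOp m) v = hitProb v := by
  rw [diagEntry, frameOp_pauli, hs, Matrix.mul_smul, Matrix.trace_smul, ← hs, hs_pauli_self,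
    smul_eq_mul, mul_div_assoc, div_self (by positivity), mul_one]

theorem isUnit_frameOp (m : ℕ) : IsUnit (frameOp m) := by
  rw [LinearMap.isUnit_iff_range_eq_top, eq_top_iff, ← span_pauli, Submodule.span_le]
  rintro _ ⟨v, rfl⟩
  refine ⟨(hitProb v)⁻¹ • pauli v, ?_⟩
  rw [map_smul, frameOp_pauli, smul_smul, inv_mul_cancel₀ (hitProb_pos v).ne', one_smul]

theorem hs_smul_sum {m : ℕ} {ι : Type*} [Fintype ι] (r : ℂ) (A : Op (m * 2)) (f : ι → Op (m * 2)) :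
    hs A (r • ∑ i, f i) = r * ∑ i, hs A (f i) := by
  simp only [hs, Matrix.mul_smul, Matrix.trace_smul, Matrix.mul_sum, Matrix.trace_sum, smul_eq_mul]

/-- The frame operator is self-adjoint. -/
theorem hs_frameOp {m : ℕ} (A B : Op (m * 2)) : hs A (frameOp m B) = hs (frameOp m A) B := by
  have h : ∀ X Y : Op (m * 2), hs X (frameOp m Y) = (Fintype.card (Circuit m) : ℂ)⁻¹ *
      ∑ c : Circuit m, ∑ i, hs (effect i c) Y * hs X (effect i c) := fun X Y => by
    rw [frameOp_apply, hs_smul_sum]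
    simp only [hs, Matrix.mul_sum, Matrix.trace_sum, Matrix.mul_smul, Matrix.trace_smul,
      smul_eq_mul]
  rw [← star_hs B, h, h, star_mul']
  simp only [star_sum, star_mul', star_hs, star_inv₀, star_natCast]
  exact congrArg _ (Finset.sum_congr rfl fun c _ => Finset.sum_congr rfl fun i _ => mul_comm _ _)

theorem hs_smul_left {n : ℕ} (s : ℂ) (A B : Op n) : hs (s • A) B = star s * hs A B := by
  rw [hs, hs, Matrix.conjTranspose_smul, Matrix.smul_mul, Matrix.trace_smul, smul_eq_mul]

theorem star_eq_self_of_nonneg {z : ℂ} (h : 0 ≤ z) : star z = z :=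
  (IsSelfAdjoint.of_nonneg h)

theorem estimator_pauli {m : ℕ} (v : PauliLabel (m * 2)) (i : Bits (m * 2)) (c : Circuit m) :
    estimator (pauli v) i c = 1 / hitProb v * hs (pauli v) (effect i c) := by
  set B := Ring.inverse (frameOp m) (effect i c) with hB
  have h1 : frameOp m B = effect i c := by
    rw [hB, ← Module.End.mul_apply, Ring.mul_inverse_cancel _ (isUnit_frameOp m),
      Module.End.one_apply]
  have h2 := hs_frameOp (pauli v) B
  rw [h1, frameOp_pauli, hs_smul_left, star_eq_self_of_nonneg (hitProb_pos v).le] at h2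
  rw [estimator, ← hB, h2, ← mul_assoc, one_div_mul_cancel (hitProb_pos v).ne', one_mul]

theorem secondMoment_eq {m : ℕ} (v : PauliLabel (m * 2)) {ρ : Op (m * 2)} (hρ : ρ.trace = 1) :
    secondMoment v ρ = 1 / hitProb v := by
  have hsum : ∀ c : Circuit m, ∑ i, hs (effect i c) ρ = 1 := fun c => by
    simp only [hs, effect_conjTranspose]
    rw [← Matrix.trace_sum, ← Finset.sum_mul, sum_effect, one_mul, hρ]
  have h1 : ∀ c : Circuit m, ∑ i, estimator (pauli v) i c ^ 2 * hs (effect i c) ρ =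
      (1 / hitProb v) ^ 2 * c.hit v := fun c => by
    simp only [estimator_pauli, mul_pow, hs_pauli_effect, c.conj_diag_sq]
    rw [← Finset.mul_sum, hsum, mul_one]
  rw [secondMoment, ← Finset.expect_sum_comm]
  simp only [h1]
  rw [← Finset.mul_expect, ← hitProb, sq, mul_assoc, one_div_mul_cancel (hitProb_pos v).ne',
    mul_one]

theorem variance_le_secondMoment {m : ℕ} (v : PauliLabel (m * 2)) {ρ : Op (m * 2)}
    (hρ : ρ.IsHermitian) : variance v ρ ≤ secondMoment v ρ := by
  rw [variance, sub_le_self_iff]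
  have hr : star (hs (pauli v) ρ) = hs (pauli v) ρ := by
    rw [star_hs, hs, hs, hρ.eq, pauli_conjTranspose, Matrix.trace_mul_comm]
  have h2 := star_mul_self_nonneg (hs (pauli v) ρ)
  rwa [hr, ← sq] at h2

end BrickworkShadows

end

theorem mainTheorem2 (m : ℕ) (v : BrickworkShadows.PauliLabel (m * 2)) :
    IsUnit (BrickworkShadows.frameOp m) ∧
    0 < BrickworkShadows.diagEntry (BrickworkShadows.frameOp m) v ∧
    (∀ (i : BrickworkShadows.Bits (m * 2)) (c : BrickworkShadows.Circuit m),
      BrickworkShadows.estimator (BrickworkShadows.pauli v) i c =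
        1 / BrickworkShadows.diagEntry (BrickworkShadows.frameOp m) v *
          BrickworkShadows.hs (BrickworkShadows.pauli v) (BrickworkShadows.effect i c)) ∧
    (∀ ρ σ : BrickworkShadows.Op (m * 2),
      BrickworkShadows.IsState ρ → BrickworkShadows.IsState σ →
        BrickworkShadows.secondMoment v ρ = BrickworkShadows.secondMoment v σ) ∧
    (∀ ρ : BrickworkShadows.Op (m * 2), BrickworkShadows.IsState ρ →
      BrickworkShadows.secondMoment v ρ ≤
        1 / BrickworkShadows.diagEntry (BrickworkShadows.frameOp m) v ∧
      BrickworkShadows.variance v ρ ≤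
        1 / BrickworkShadows.diagEntry (BrickworkShadows.frameOp m) v) := by
  open BrickworkShadows in
  rw [diagEntry_frameOp]
  refine ⟨isUnit_frameOp m, hitProb_pos v, estimator_pauli v, fun ρ σ hρ hσ => ?_, fun ρ hρ => ?_⟩
  · rw [secondMoment_eq v hρ.2, secondMoment_eq v hσ.2]
  · rw [← secondMoment_eq v hρ.2]
    exact ⟨le_rfl, variance_le_secondMoment v hρ.1.isHermitian⟩
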